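/- **Setting.** Let $d\in\mathbb N$, $T>0$, $p\in[1,\infty)$, and let $C_T=C([0,T],\mathbb R^d)$ with the supremum norm; $\mathbb R^d\times C_T$ carries the maximum norm $\max(|x|,\|\gamma\|_\infty)$. For a normed space $E$ let $\mathcal P_p(E)$ be the set of Borel probability measures $\mu$ on $E$ with $\int\|x\|^p\,d\mu<\infty$, with the Wasserstein distance $\mathcal W_p(\mu,\nu)^p=\inf_m\iint\|x-y\|^p\,m(dx,dy)$, the infimum being over all couplings $m$ of $\mu$ and $\nu$. Write $\mathcal L(Y)$ for the law of a random variable $Y$ and $\mu_t$ for the marginal at time $t$ of $\mu\in\mathcal P_p(C_T)$. Let $b:[0,T]\times\mathbb R^d\times\mathcal P_p(\mathbb R^d)\to\mathbb R^d$ be measurable in $t$ for all fixed $(x,\mu)$ (for instance jointly measurable), with $\int_0^T|b(t,x,\mu)|\,dt<\infty$ for some (equivalently, every) $(x,\mu)$, and suppose that there is a constant $K_b$ with $$|b(t,x,\mu)-b(t,x',\mu')|^p\le K_b\big(|x-x'|^p+\mathcal W_p(\mu,\mu')^p\big)\qquad\text{for all } t,x,x',\mu,\mu'.$$ An *input* is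 a random variable $(\zeta,W)\in L^p(\Omega,\mathbb P;\mathbb R^d\times C_T)$ on some probability space. A *solution* of $$dX_t=b(t,X_t,\mathcal L(X_t))\,dt+dW_t,\qquad X_0=\zeta, \tag{1}$$ is a random variable $X:\Omega\to C_T$ with $\mathcal L(X_t)\in\mathcal P_p(\mathbb R^d)$ for all $t$ such that for almost every $\omega$ the integrand below is integrable on $[0,T]$ and $X_t(\omega)=\zeta(\omega)+\int_0^t b(s,X_s(\omega),\mathcal L(X_s))\,ds+W_t(\omega)$ for all $t\in[0,T]$. For $\mu\in\mathcal P_p(C_T)$ let $S^\mu(x_0,\gamma)\in C_T$ be the solution $x$ of $x_t=x_0+\int_0^t b(s,x_s,\mu_s)\,ds+\gamma_t$, $t\in[0,T]$, and let $\Phi(\nu,\mu)=(S^\mu)_\#\nu$ for $\nu\in\mathcal P_p(\mathbb R^d\times C_T)$. **Theorem.** For every $\mu\in\mathcal P_p(C_T)$ and $(x_0,\gamma)\in\mathbb R^d\times C_T$ the integral equation defining $S^\mu(x_0,\gamma)$ has exactly one solution, $S^\mu$ is Borel measurable, and $\Phi$ takes values in $\mathcal P_p(C_T)$. Moreover: 1.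 For every $\nu\in\mathcal P_p(\mathbb R^d\times C_T)$ (that is, for the law $\nu=\mathcal L(\zeta,W)$ of any input), the map $\Phi(\nu,\cdot)$ has a unique fixed point $\mu^{\nu}\in\mathcal P_p(C_T)$. 2. The map $\Psi:\mathcal P_p(\mathbb R^d\times C_T)\to\mathcal P_p(C_T)$, $\nu\mapsto\mu^\nu$, is well defined and Lipschitz continuous for $\mathcal W_p$. 3. For every input $(\zeta,W)$, $X=S^{\Psi(\mathcal L(\zeta,W))}(\zeta,W)$ is a solution of (1); it belongs to $L^p(\Omega;C_T)$, has law $\Psi(\mathcal L(\zeta,W))$, and every solution of (1) with input $(\zeta,W)$ is almost surely equal to $X$. 4. There is a constant $C=C(p,T,b)>0$ such that for any two inputs $(\zeta^i,W^i)$, $i=1,2$, possibly defined on different probability spaces, with corresponding solutions $X^i$, $$\mathcal W_p(\mathcal L(X^1),\mathcal L(X^2))\le C\,\mathcal W_p(\mathcal L(\zeta^1,W^1),\mathcal L(\zeta^2,W^2)).$$ In particular, the law of a solution depends only on the law of the input. -/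

import Mathlib

open MeasureTheory
open scoped NNReal ENNReal

namespace McKeanVlasov

/-- `ℝ^d` with its Euclidean norm. -/
abbrev Space (d : ℕ) : Type := EuclideanSpace ℝ (Fin d)

/-- `C_T = C([0,T], ℝ^d)`; Mathlib equips it with the supremum norm. -/
abbrev PathSpace (T : ℝ) (d : ℕ) : Type := C(Set.Icc (0 : ℝ) T, Space d)

/-- `C_T` carries its Borel sigma-algebra. -/
instance instMeasurableSpacePathSpace (T : ℝ) (d : ℕ) : MeasurableSpace (PathSpace T d) :=
  borel _

instance instBorelSpacePathSpace (T : ℝ) (d : ℕ) : BorelSpace (PathSpace T d) := ⟨rfl⟩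

/-- `𝒫_p(E)`: the probability measures on the normed space `E` with finite `p`-th moment. -/
def FiniteMoment (p : ℝ≥0) (E : Type*) [MeasurableSpace E] [NormedAddCommGroup E] : Type _ :=
  {μ : Measure E // IsProbabilityMeasure μ ∧ ∫⁻ x, ‖x‖ₑ ^ (p : ℝ) ∂μ < ∞}

/-- The couplings `Γ(μ, ν)`: measures on `E × E` with first marginal `μ`, second marginal `ν`. -/
def couplings {E : Type*} [MeasurableSpace E] (μ ν : Measure E) : Set (Measure (E × E)) :=
  {m | m.map Prod.fst = μ ∧ m.map Prod.snd = ν}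

/-- The `p`-Wasserstein distance
`𝒲_p(μ, ν) = (inf_{m ∈ Γ(μ, ν)} ∫ d(x, y)^p m(dx, dy))^{1/p}`, with values in `[0, ∞]`. -/
noncomputable def wasserstein (p : ℝ≥0) {E : Type*} [MeasurableSpace E] [PseudoEMetricSpace E]
    (μ ν : Measure E) : ℝ≥0∞ :=
  (⨅ m ∈ couplings μ ν, ∫⁻ z, edist z.1 z.2 ^ (p : ℝ) ∂m) ^ (1 / (p : ℝ))

/-- The law `ℒ(X)` of a random variable `X ∈ L^p(Ω, P; E)`, as an element of `𝒫_p(E)`. -/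
noncomputable def law {p : ℝ≥0} {Ω E : Type*} [MeasurableSpace Ω] [MeasurableSpace E]
    [NormedAddCommGroup E] [BorelSpace E] {P : Measure Ω} [IsProbabilityMeasure P]
    {X : Ω → E} (hX : MemLp X (p : ℝ≥0∞) P) : FiniteMoment p E :=
  ⟨P.map X, Measure.isProbabilityMeasure_map hX.1.aemeasurable, by
    rw [lintegral_map' (by fun_prop) hX.1.aemeasurable]
    by_cases hp : p = 0
    · simp [hp]
    · exact lintegral_rpow_enorm_lt_top_of_eLpNorm_lt_top (p := (p : ℝ≥0∞))
        (by exact_mod_cast hp) ENNReal.coe_ne_top hX.2⟩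

/-- The time marginal `μ_t = (π_t)_# μ ∈ 𝒫_p(ℝ^d)` of `μ ∈ 𝒫_p(C_T)`. -/
noncomputable def marginal {p : ℝ≥0} {T : ℝ} {d : ℕ} (μ : FiniteMoment p (PathSpace T d))
    (t : Set.Icc (0 : ℝ) T) : FiniteMoment p (Space d) :=
  have hm : Measurable (fun γ : PathSpace T d => γ t) :=
    (continuous_eval_const (F := PathSpace T d) t).measurable
  ⟨μ.1.map (fun γ => γ t), by
    have := μ.2.1
    exact Measure.isProbabilityMeasure_map hm.aemeasurable, by
    rw [lintegral_map (by fun_prop) hm]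
    refine lt_of_le_of_lt (lintegral_mono fun γ => ?_) μ.2.2
    exact ENNReal.rpow_le_rpow
      (enorm_le_iff_norm_le.2 (ContinuousMap.norm_coe_le_norm γ t)) p.2⟩

/-- A drift `b : [0,T] × ℝ^d × 𝒫_p(ℝ^d) → ℝ^d`. -/
abbrev Drift (p : ℝ≥0) (T : ℝ) (d : ℕ) : Type :=
  Set.Icc (0 : ℝ) T → Space d → FiniteMoment p (Space d) → Space d

/-- Lebesgue measure on `[0,T]`. -/
noncomputable def timeMeasure (T : ℝ) : Measure (Set.Icc (0 : ℝ) T) :=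
  Measure.comap Subtype.val volume

/-- The standing assumptions on the drift.  Only measurability in time is required; for a drift
that is Lipschitz in `(x, μ)` this is implied by joint measurability.  The field `integrable`
makes the time integrals in the equation meaningful; by `lipschitz`, it holds for one pair
`(x, μ)` if and only if it holds for all of them. -/
structure DriftAssumption {p : ℝ≥0} {T : ℝ} {d : ℕ} (b : Drift p T d) : Prop where
  measurable : ∀ x μ, Measurable fun t => b t x μ
  lipschitz : ∃ K : ℝ≥0, ∀ t x x' μ μ',
    ‖b t x μ - b t x' μ'‖ₑ ^ (p : ℝ) ≤
      K * (‖x - x'‖ₑ ^ (p : ℝ) + wasserstein p μ.1 μ'.1 ^ (p : ℝ))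
  integrable : ∃ x μ, Integrable (fun t => b t x μ) (timeMeasure T)

/-- For a flow `m : [0,T] → 𝒫_p(ℝ^d)` of measures, the path `x ∈ C_T` solves
`x_t = x₀ + ∫_0^t b(s, x_s, m_s) ds + γ_t` for all `t ∈ [0,T]`
(the integrand being Lebesgue integrable on `[0,T]`). -/
def IsPathSolution {p : ℝ≥0} {T : ℝ} {d : ℕ} (b : Drift p T d)
    (m : Set.Icc (0 : ℝ) T → FiniteMoment p (Space d))
    (x₀ : Space d) (γ x : PathSpace T d) : Prop :=
  Integrable (fun s => b s (x s) (m s)) (timeMeasure T) ∧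
    ∀ t, x t = x₀ + (∫ s in Set.Iic t, b s (x s) (m s) ∂timeMeasure T) + γ t

open Classical in
/-- The solution map `S^μ : ℝ^d × C_T → C_T`, which sends `(x₀, γ)` to a solution of the integral
equation driven by the marginals of `μ ∈ 𝒫_p(C_T)` (and to `0` if there were none). -/
noncomputable def solutionMap {p : ℝ≥0} {T : ℝ} {d : ℕ} (b : Drift p T d)
    (μ : FiniteMoment p (PathSpace T d)) (z : Space d × PathSpace T d) : PathSpace T d :=
  if h : ∃ x, IsPathSolution b (marginal μ) z.1 z.2 x then h.choose else 0

/-- `Φ(ν, μ) = (S^μ)_# ν`. -/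
noncomputable def lawMap {p : ℝ≥0} {T : ℝ} {d : ℕ} (b : Drift p T d)
    (ν : FiniteMoment p (Space d × PathSpace T d)) (μ : FiniteMoment p (PathSpace T d)) :
    Measure (PathSpace T d) :=
  ν.1.map (solutionMap b μ)

/-- `X` is a (pathwise) solution of `dX_t = b(t, X_t, ℒ(X_t)) dt + dW_t`, `X_0 = ζ`: a random
variable in `C_T` whose time marginals lie in `𝒫_p(ℝ^d)` and which for almost every `ω` satisfies
`X_t(ω) = ζ(ω) + ∫_0^t b(s, X_s(ω), ℒ(X_s)) ds + W_t(ω)` for all `t ∈ [0,T]`. -/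
def IsSolution {p : ℝ≥0} {T : ℝ} {d : ℕ} (b : Drift p T d) {Ω : Type*} [MeasurableSpace Ω]
    (P : Measure Ω) [IsProbabilityMeasure P] (ζ : Ω → Space d) (W X : Ω → PathSpace T d) : Prop :=
  AEMeasurable X P ∧
    ∃ h : ∀ s, MemLp (fun ω => X ω s) (p : ℝ≥0∞) P,
      ∀ᵐ ω ∂P, IsPathSolution b (fun s => law (h s)) (ζ ω) (W ω) (X ω)

end McKeanVlasov

/-!
# Well-posedness of McKean-Vlasov equations with additive random input

All estimates use the weighted supremum norm `sup_t exp (-l t) |x_t|` on path space, written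
`‖expWeight l x‖`. Integration in time gains a factor `1 / l` in this norm
(`norm_expWeight_sub_le`), so for a `K`-Lipschitz drift and `l = 4 K` every term that a Gronwall
argument would iterate can be absorbed on the left-hand side at once.

* For a fixed flow of measures the Picard map is a contraction, which gives `S^μ`
  (`exists_integral_equation`); the drift along a path is measurable in time because the marginals
  of `μ` are continuous for `𝒲_p` (`tendsto_wasserstein_marginal`). Comparing two paths
  (`IsPathSolution.norm_expWeight_sub_le`) shows that `S^μ` is unique and Lipschitz continuous.
* Two solutions on one probability space with time marginals `μ_s`, `μ'_s` couple these marginals,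
  so `𝒲_p(μ_s, μ'_s)` is at most `exp (l s)` times the weighted `L^p` distance of the solutions.
  Taking `L^p` norms of the pathwise estimate and absorbing bounds that distance by the `L^p`
  distance of the inputs (`eLpNorm_sub_le_of_isPathSolution`). With equal inputs this is uniqueness
  of the fixed point; on an arbitrary coupling of two input laws it is the Lipschitz continuity
  of `Ψ`.
* A fixed point of `Φ(ν, ·)` is the law of the fixed point of the contraction `X ↦ S^{ℒ(X)}` of the
  complete space `L^p(ν; C_T)` (`exists_lawMap_eq`); completeness of `𝒲_p` is not needed.
* A solution is compared pathwise with one of its own paths, so it lies in `L^p(Ω; C_T)`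
  (`IsSolution.memLp`). Its law is then a fixed point of `Φ(ν, ·)`, and the solution is the image of
  its input under `S^μ` (`IsSolution.map_eq_and_ae_eq`).
-/

namespace McKeanVlasov

open Set Filter Topology

/-! ### Integral equations in the weighted supremum norm -/

section Time

variable {T : ℝ} {E : Type*} [NormedAddCommGroup E] [NormedSpace ℝ E]

instance isFiniteMeasure_timeMeasure (T : ℝ) : IsFiniteMeasure (timeMeasure T) := by
  constructor
  rw [timeMeasure, comap_subtype_coe_apply measurableSet_Icc]
  exact (measure_mono (Subtype.coe_image_subset _ _)).trans_lt measure_Icc_lt_top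

theorem setIntegral_timeMeasure (hT : 0 ≤ T) (f : Icc (0 : ℝ) T → E) (t : Icc (0 : ℝ) T) :
    ∫ s in Iic t, f s ∂timeMeasure T = ∫ s in Ioc (0 : ℝ) t, f (projIcc 0 T hT s) := by
  rw [← integral_indicator measurableSet_Iic, ← integral_Icc_eq_integral_Ioc]
  have h := integral_subtype_comap (μ := volume) (measurableSet_Icc (a := (0 : ℝ)) (b := T))
    ((Iic (t : ℝ)).indicator fun s => f (projIcc 0 T hT s))
  rw [setIntegral_indicator measurableSet_Iic] at h
  have hI : Icc (0 : ℝ) T ∩ Iic (t : ℝ) = Icc 0 (t : ℝ) := by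
    ext s
    exact ⟨fun hs => ⟨hs.1.1, hs.2⟩, fun hs => ⟨⟨hs.1, hs.2.trans t.2.2⟩, hs.2⟩⟩
  rw [hI] at h
  rw [← h, timeMeasure]
  congr 1
  ext s
  by_cases hs : s ≤ t
  · rw [indicator_of_mem (by exact hs), indicator_of_mem (by exact hs), projIcc_val]
  · rw [indicator_of_notMem (by exact hs), indicator_of_notMem (by exact hs)]

theorem integrableOn_comp_projIcc {F : Type*} [NormedAddCommGroup F] (hT : 0 ≤ T)
    {f : Icc (0 : ℝ) T → F} (hf : Integrable f (timeMeasure T)) :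
    IntegrableOn (fun s => f (projIcc 0 T hT s)) (Icc 0 T) := by
  rw [IntegrableOn, ← map_comap_subtype_coe measurableSet_Icc,
    (MeasurableEmbedding.subtype_coe measurableSet_Icc).integrable_map_iff]
  refine (integrable_congr (Eventually.of_forall fun s => ?_)).1 hf
  simp

theorem continuous_setIntegral_timeMeasure (hT : 0 ≤ T) {f : Icc (0 : ℝ) T → E}
    (hf : Integrable f (timeMeasure T)) :
    Continuous fun t => ∫ s in Iic t, f s ∂timeMeasure T := by
  simp_rw [setIntegral_timeMeasure hT]
  exact continuousOn_iff_continuous_domRestrict.1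
    (intervalIntegral.continuousOn_primitive (integrableOn_comp_projIcc hT hf))

theorem integrable_exp_timeMeasure (l : ℝ) :
    Integrable (fun s : Icc (0 : ℝ) T => Real.exp (l * s)) (timeMeasure T) := by
  have hc : Continuous fun s : Icc (0 : ℝ) T => Real.exp (l * s) := by fun_prop
  refine Integrable.of_bound hc.aestronglyMeasurable (Real.exp (|l| * T))
    (Eventually.of_forall fun s => ?_)
  rw [Real.norm_of_nonneg (Real.exp_pos _).le]
  refine Real.exp_le_exp.2 ?_
  exact mul_le_mul (le_abs_self l) s.2.2 s.2.1 (abs_nonneg l)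

theorem setIntegral_exp_timeMeasure_le {l : ℝ} (hl : 0 < l) (t : Icc (0 : ℝ) T) :
    ∫ s in Iic t, Real.exp (l * s) ∂timeMeasure T ≤ Real.exp (l * t) / l := by
  have hT : 0 ≤ T := t.2.1.trans t.2.2
  have h : ∫ s in Iic t, Real.exp (l * s) ∂timeMeasure T = ∫ s in (0 : ℝ)..t, Real.exp (l * s) := by
    rw [setIntegral_timeMeasure hT, intervalIntegral.integral_of_le t.2.1]
    refine setIntegral_congr_fun measurableSet_Ioc fun s hs => ?_
    rw [projIcc_of_mem hT ⟨hs.1.le, hs.2.trans t.2.2⟩]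
  rw [h, intervalIntegral.integral_comp_mul_left _ hl.ne', integral_exp, smul_eq_mul,
    div_eq_inv_mul]
  gcongr
  simp

end Time

section Weight

variable {T : ℝ} {d : ℕ}

/-- Multiplication of a path by the weight `exp (-l t)`. The norm of `expWeight l x` is the weighted
supremum norm `sup_t exp (-l t) |x_t|` of `x`, and `expWeight (-l)` inverts `expWeight l`. -/
noncomputable def expWeight (l : ℝ) : PathSpace T d →L[ℝ] PathSpace T d :=
  LinearMap.mkContinuous
    { toFun := fun x => ⟨fun t => Real.exp (-(l * t)) • x t, by fun_prop⟩
      map_add' := fun x y => by ext1 t; exact smul_add (Real.exp (-(l * t))) (x t) (y t)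
      map_smul' := fun c x => by ext1 t; exact smul_comm (Real.exp (-(l * t))) c (x t) }
    (Real.exp (|l| * T)) fun x => by
      refine (ContinuousMap.norm_le _ (by positivity)).2 fun t => ?_
      change ‖Real.exp (-(l * t)) • x t‖ ≤ _
      rw [norm_smul, Real.norm_of_nonneg (Real.exp_pos _).le]
      refine mul_le_mul (Real.exp_le_exp.2 ?_) (x.norm_coe_le_norm t) (norm_nonneg _)
        (Real.exp_pos _).le
      rw [← neg_mul]
      exact mul_le_mul (neg_le_abs l) t.2.2 t.2.1 (abs_nonneg l)

theorem expWeight_apply (l : ℝ) (x : PathSpace T d) (t : Icc (0 : ℝ) T) :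
    expWeight l x t = Real.exp (-(l * t)) • x t := rfl

theorem expWeight_neg_expWeight (l : ℝ) (x : PathSpace T d) :
    expWeight (-l) (expWeight l x) = x := by
  ext1 t
  rw [expWeight_apply, expWeight_apply, smul_smul, ← Real.exp_add]
  simp

theorem expWeight_expWeight_neg (l : ℝ) (x : PathSpace T d) :
    expWeight l (expWeight (-l) x) = x := by
  simpa using expWeight_neg_expWeight (-l) x

theorem norm_apply_le_exp_mul (l : ℝ) (x : PathSpace T d) (t : Icc (0 : ℝ) T) :
    ‖x t‖ ≤ Real.exp (l * t) * ‖expWeight l x‖ := by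
  have h : x t = Real.exp (l * t) • expWeight l x t := by
    rw [expWeight_apply, smul_smul, ← Real.exp_add]
    simp
  rw [h, norm_smul, Real.norm_of_nonneg (Real.exp_pos _).le]
  gcongr
  exact (expWeight l x).norm_coe_le_norm t

theorem norm_le_exp_mul_norm_expWeight {l : ℝ} (hl : 0 ≤ l) (x : PathSpace T d) :
    ‖x‖ ≤ Real.exp (l * T) * ‖expWeight l x‖ := by
  refine (ContinuousMap.norm_le _ (by positivity)).2 fun t => (norm_apply_le_exp_mul l x t).trans ?_
  gcongr
  exact t.2.2

/-- The only estimate on integral equations that is needed: since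
`exp (-l t) ∫_0^t exp (l s) ds ≤ 1 / l`, integration gains a factor `1 / l` in the weighted norm. -/
theorem norm_expWeight_sub_le {l M : ℝ} (hl : 0 < l) (hM : 0 ≤ M) {x y : PathSpace T d}
    {x₀ y₀ : Space d} {γ η : PathSpace T d} {f g : Icc (0 : ℝ) T → Space d}
    (hf : Integrable f (timeMeasure T)) (hg : Integrable g (timeMeasure T))
    (hx : ∀ t, x t = x₀ + (∫ s in Iic t, f s ∂timeMeasure T) + γ t)
    (hy : ∀ t, y t = y₀ + (∫ s in Iic t, g s ∂timeMeasure T) + η t)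
    (hfg : ∀ s : Icc (0 : ℝ) T, ‖f s - g s‖ ≤ Real.exp (l * s) * M) :
    ‖expWeight l (x - y)‖ ≤ ‖x₀ - y₀‖ + ‖γ - η‖ + M / l := by
  refine (ContinuousMap.norm_le _ (by positivity)).2 fun t => ?_
  have hint : ‖∫ s in Iic t, (f s - g s) ∂timeMeasure T‖ ≤ Real.exp (l * t) * (M / l) := by
    calc ‖∫ s in Iic t, (f s - g s) ∂timeMeasure T‖
        ≤ ∫ s in Iic t, Real.exp (l * s) * M ∂timeMeasure T :=
          norm_integral_le_of_norm_le ((integrable_exp_timeMeasure l).mul_const M).integrableOn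
            (Eventually.of_forall hfg)
      _ = (∫ s in Iic t, Real.exp (l * s) ∂timeMeasure T) * M := integral_mul_const _ _
      _ ≤ Real.exp (l * t) / l * M := by
          gcongr
          exact setIntegral_exp_timeMeasure_le hl t
      _ = Real.exp (l * t) * (M / l) := by ring
  have heq : (x - y) t = (x₀ - y₀) + (γ - η) t + ∫ s in Iic t, (f s - g s) ∂timeMeasure T := by
    rw [integral_sub hf.integrableOn hg.integrableOn, ContinuousMap.sub_apply,
      ContinuousMap.sub_apply, hx, hy]
    abel
  have h1 : ‖(x - y) t‖ ≤ ‖x₀ - y₀‖ + ‖γ - η‖ + Real.exp (l * t) * (M / l) := by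
    rw [heq]
    exact norm_add₃_le.trans (add_le_add (add_le_add le_rfl ((γ - η).norm_coe_le_norm t)) hint)
  have hexp : Real.exp (-(l * t)) ≤ 1 :=
    Real.exp_le_one_iff.2 (neg_nonpos.2 (mul_nonneg hl.le t.2.1))
  rw [expWeight_apply, norm_smul, Real.norm_of_nonneg (Real.exp_pos _).le]
  calc Real.exp (-(l * t)) * ‖(x - y) t‖
      ≤ Real.exp (-(l * t)) * (‖x₀ - y₀‖ + ‖γ - η‖ + Real.exp (l * t) * (M / l)) := by gcongr
    _ = Real.exp (-(l * t)) * (‖x₀ - y₀‖ + ‖γ - η‖) + M / l := by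
        rw [mul_add, ← mul_assoc, ← Real.exp_add]
        simp
    _ ≤ 1 * (‖x₀ - y₀‖ + ‖γ - η‖) + M / l := by gcongr
    _ = _ := by rw [one_mul]

/-- Existence for an integral equation with a Lipschitz drift: in the norm weighted with rate `2 K`,
the Picard map is a contraction. -/
theorem exists_integral_equation (hT : 0 ≤ T) {B : Icc (0 : ℝ) T → Space d → Space d} {K : ℝ}
    (hK : 0 < K) (hB : ∀ s x y, ‖B s x - B s y‖ ≤ K * ‖x - y‖)
    (hint : ∀ x : PathSpace T d, Integrable (fun s => B s (x s)) (timeMeasure T))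
    (x₀ : Space d) (γ : PathSpace T d) :
    ∃ x : PathSpace T d, ∀ t, x t = x₀ + (∫ s in Iic t, B s (x s) ∂timeMeasure T) + γ t := by
  let F : PathSpace T d → PathSpace T d := fun x =>
    ⟨fun t => x₀ + (∫ s in Iic t, B s (x s) ∂timeMeasure T) + γ t,
      (continuous_const.add (continuous_setIntegral_timeMeasure hT (hint x))).add γ.continuous⟩
  have hF : ContractingWith (1 / 2)
      (fun x : PathSpace T d => expWeight (2 * K) (F (expWeight (-(2 * K)) x))) := by
    refine ⟨by rw [← NNReal.coe_lt_coe]; norm_num, LipschitzWith.of_dist_le_mul fun x y => ?_⟩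
    rw [dist_eq_norm, dist_eq_norm, ← map_sub]
    refine (norm_expWeight_sub_le (x₀ := x₀) (y₀ := x₀) (γ := γ) (η := γ) (M := K * ‖x - y‖)
      (by positivity) (by positivity) (hint _) (hint _) (fun t => rfl) (fun t => rfl)
      fun s => (hB s _ _).trans ?_).trans ?_
    · have h := norm_apply_le_exp_mul (2 * K) (expWeight (-(2 * K)) (x - y)) s
      rw [expWeight_expWeight_neg, map_sub, ContinuousMap.sub_apply] at h
      calc _ ≤ K * (Real.exp (2 * K * s) * ‖x - y‖) := by gcongr
        _ = _ := by ring
    · simp only [sub_self, norm_zero, NNReal.coe_div, NNReal.coe_one, NNReal.coe_ofNat]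
      apply le_of_eq
      field_simp
      ring
  obtain ⟨y, hy, -⟩ := hF.exists_fixedPoint 0 (edist_ne_top _ _)
  refine ⟨expWeight (-(2 * K)) y, fun t => ?_⟩
  have h : expWeight (-(2 * K)) y = F (expWeight (-(2 * K)) y) := by
    conv_lhs => rw [← hy.eq, expWeight_neg_expWeight]
  exact congrArg (fun z : PathSpace T d => z t) h

end Weight

/-! ### Wasserstein distance of laws and of time marginals -/

section Wasserstein

variable {p : ℝ≥0} {E : Type*} [MeasurableSpace E] [NormedAddCommGroup E]

theorem memLp_id_of_finiteMoment [BorelSpace E] [SecondCountableTopology E] (hp : 1 ≤ p)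
    (μ : FiniteMoment p E) : MemLp id (p : ℝ≥0∞) μ.1 := by
  have hp0 : p ≠ 0 := (zero_lt_one.trans_le hp).ne'
  refine ⟨measurable_id.aestronglyMeasurable, ?_⟩
  rw [eLpNorm_lt_top_iff_lintegral_rpow_enorm_lt_top (by exact_mod_cast hp0) ENNReal.coe_ne_top]
  exact μ.2.2

/-- Two random variables on the same space give a coupling of their laws. -/
theorem wasserstein_map_le [BorelSpace E] [SecondCountableTopology E] (hp : 1 ≤ p)
    {Ω : Type*} [MeasurableSpace Ω] {P : Measure Ω} {X Y : Ω → E} (hX : AEMeasurable X P)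
    (hY : AEMeasurable Y P) :
    wasserstein p (P.map X) (P.map Y) ≤ eLpNorm (X - Y) (p : ℝ≥0∞) P := by
  have hp0 : p ≠ 0 := (zero_lt_one.trans_le hp).ne'
  rw [eLpNorm_eq_lintegral_rpow_enorm_toReal (by exact_mod_cast hp0) ENNReal.coe_ne_top,
    wasserstein, ENNReal.coe_toReal]
  refine ENNReal.rpow_le_rpow ?_ (by positivity)
  have hXY : AEMeasurable (fun ω => (X ω, Y ω)) P := hX.prodMk hY
  have hm : P.map (fun ω => (X ω, Y ω)) ∈ couplings (P.map X) (P.map Y) := by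
    constructor
    · rw [AEMeasurable.map_map_of_aemeasurable measurable_fst.aemeasurable hXY]; rfl
    · rw [AEMeasurable.map_map_of_aemeasurable measurable_snd.aemeasurable hXY]; rfl
  refine (iInf₂_le _ hm).trans ((lintegral_map_le _ _).trans (le_of_eq ?_))
  simp [edist_eq_enorm_sub]

theorem wasserstein_self [BorelSpace E] [SecondCountableTopology E] (hp : 1 ≤ p) (μ : Measure E) :
    wasserstein p μ μ = 0 := by
  have h := wasserstein_map_le hp (P := μ) (X := id) (Y := id) aemeasurable_id aemeasurable_id
  simpa using h

/-- A lower bound for the `L^p` distance of the two coordinates under every coupling passes to the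
infimum. -/
theorem le_mul_wasserstein [BorelSpace E] [SecondCountableTopology E] (hp : 1 ≤ p)
    {μ ν : Measure E} {D : ℝ≥0∞} {C : ℝ≥0} (hC : 0 < C)
    (h : ∀ m ∈ couplings μ ν,
      D ≤ C * eLpNorm (fun z : E × E => z.1 - z.2) (p : ℝ≥0∞) m) :
    D ≤ C * wasserstein p μ ν := by
  have hp0 : (0 : ℝ) < p := by exact_mod_cast zero_lt_one.trans_le hp
  have hC0 : (C : ℝ≥0∞) ≠ 0 := by exact_mod_cast hC.ne'
  rw [mul_comm, ← ENNReal.div_le_iff hC0 ENNReal.coe_ne_top, wasserstein, one_div,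
    ENNReal.le_rpow_inv_iff hp0]
  refine le_iInf₂ fun m hm => ?_
  have h1 := h m hm
  rw [mul_comm, ← ENNReal.div_le_iff hC0 ENNReal.coe_ne_top,
    eLpNorm_eq_lintegral_rpow_enorm_toReal (by exact_mod_cast hp0.ne') ENNReal.coe_ne_top,
    ENNReal.coe_toReal, one_div, ENNReal.le_rpow_inv_iff hp0] at h1
  simpa [edist_eq_enorm_sub] using h1

/-- The product coupling bounds the distance by the moments. -/
theorem wasserstein_le_add [BorelSpace E] [SecondCountableTopology E] (hp : 1 ≤ p)
    (μ ν : FiniteMoment p E) :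
    wasserstein p μ.1 ν.1 ≤ eLpNorm id (p : ℝ≥0∞) μ.1 + eLpNorm id (p : ℝ≥0∞) ν.1 := by
  have := μ.2.1
  have := ν.2.1
  have hid {m : Measure E} : AEStronglyMeasurable (id : E → E) m :=
    measurable_id.aestronglyMeasurable
  have h := wasserstein_map_le hp (P := μ.1.prod ν.1) (X := Prod.fst) (Y := Prod.snd)
    measurable_fst.aemeasurable measurable_snd.aemeasurable
  rw [Measure.map_fst_prod, Measure.map_snd_prod] at h
  simp only [measure_univ, one_smul] at h
  refine h.trans ((eLpNorm_sub_le measurable_fst.aestronglyMeasurable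
    measurable_snd.aestronglyMeasurable (by exact_mod_cast hp)).trans (le_of_eq ?_))
  congr 1
  · exact eLpNorm_comp_measurePreserving hid (measurePreserving_fst (μ := μ.1) (ν := ν.1))
  · exact eLpNorm_comp_measurePreserving hid (measurePreserving_snd (μ := μ.1) (ν := ν.1))

end Wasserstein

section Marginal

variable {p : ℝ≥0} {T : ℝ} {d : ℕ}

theorem measurable_eval (t : Icc (0 : ℝ) T) : Measurable fun x : PathSpace T d => x t :=
  (continuous_eval_const (F := PathSpace T d) t).measurable

theorem eLpNorm_marginal_le (μ : FiniteMoment p (PathSpace T d)) (t : Icc (0 : ℝ) T) :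
    eLpNorm id (p : ℝ≥0∞) (marginal μ t).1 ≤ eLpNorm id (p : ℝ≥0∞) μ.1 := by
  change eLpNorm id (p : ℝ≥0∞) (μ.1.map fun γ => γ t) ≤ _
  rw [eLpNorm_map_measure measurable_id.aestronglyMeasurable (measurable_eval t).aemeasurable]
  exact eLpNorm_mono fun γ => γ.norm_coe_le_norm t

/-- The marginals of a measure on path space depend continuously on time. -/
theorem tendsto_wasserstein_marginal (hp : 1 ≤ p) (μ : FiniteMoment p (PathSpace T d))
    (t : Icc (0 : ℝ) T) :
    Tendsto (fun s => wasserstein p (marginal μ s).1 (marginal μ t).1) (𝓝 t) (𝓝 0) := by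
  have hp0 : (0 : ℝ) < p := by exact_mod_cast zero_lt_one.trans_le hp
  have hle : ∀ s, wasserstein p (marginal μ s).1 (marginal μ t).1 ≤
      (∫⁻ γ : PathSpace T d, ‖γ s - γ t‖ₑ ^ (p : ℝ) ∂μ.1) ^ (1 / (p : ℝ)) := fun s => by
    have h := wasserstein_map_le hp (P := μ.1) (measurable_eval s).aemeasurable
      (measurable_eval t).aemeasurable
    rwa [eLpNorm_eq_lintegral_rpow_enorm_toReal (by exact_mod_cast hp0.ne') ENNReal.coe_ne_top]
      at h
  have hlim : Tendsto (fun s => ∫⁻ γ : PathSpace T d, ‖γ s - γ t‖ₑ ^ (p : ℝ) ∂μ.1) (𝓝 t)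
      (𝓝 (∫⁻ _ : PathSpace T d, 0 ∂μ.1)) := by
    refine tendsto_lintegral_filter_of_dominated_convergence
      (fun γ => 2 ^ (p : ℝ) * ‖γ‖ₑ ^ (p : ℝ))
      (Eventually.of_forall fun s => ?_) (Eventually.of_forall fun s => ae_of_all _ fun γ => ?_)
      ?_ (ae_of_all _ fun γ => ?_)
    · exact ((measurable_eval s).sub (measurable_eval t)).enorm.pow_const _
    · rw [← ENNReal.mul_rpow_of_nonneg _ _ hp0.le]
      refine ENNReal.rpow_le_rpow ?_ hp0.le
      rw [two_mul]
      refine (enorm_sub_le).trans (add_le_add ?_ ?_) <;>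
        exact enorm_le_iff_norm_le.2 (γ.norm_coe_le_norm _)
    · rw [lintegral_const_mul _ (by fun_prop)]
      exact ENNReal.mul_ne_top (ENNReal.rpow_ne_top_of_nonneg hp0.le (by simp)) μ.2.2.ne
    · have hc : Continuous fun s => ‖γ s - γ t‖ₑ ^ (p : ℝ) :=
        (ENNReal.continuous_rpow_const).comp (by fun_prop)
      have := hc.tendsto t
      simpa [ENNReal.zero_rpow_of_pos hp0] using this
  have h2 : Tendsto (fun s => (∫⁻ γ : PathSpace T d, ‖γ s - γ t‖ₑ ^ (p : ℝ) ∂μ.1) ^ (1 / (p : ℝ)))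
      (𝓝 t) (𝓝 0) := by
    have := ((ENNReal.continuous_rpow_const (y := 1 / (p : ℝ))).tendsto _).comp hlim
    simpa [ENNReal.zero_rpow_of_pos (inv_pos.2 hp0), Function.comp_def] using this
  exact tendsto_of_tendsto_of_tendsto_of_le_of_le tendsto_const_nhds h2 (fun _ => zero_le) hle

end Marginal

/-! ### The solution map for a given flow of measures -/

theorem memLp_of_norm_sub_const_le {Ω E F : Type*} [MeasurableSpace Ω] [NormedAddCommGroup E]
    [NormedAddCommGroup F] {q : ℝ≥0∞} {P : Measure Ω} [IsFiniteMeasure P] {f : Ω → E} {g : Ω → F}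
    {c : E} {C : ℝ} (hf : AEStronglyMeasurable f P) (hg : MemLp g q P)
    (h : ∀ᵐ ω ∂P, ‖f ω - c‖ ≤ C * ‖g ω‖) : MemLp f q P := by
  have h1 : MemLp (fun ω => f ω - c) q P := hg.of_le_mul (hf.sub aestronglyMeasurable_const) h
  exact (h1.add (memLp_const c)).ae_eq (ae_of_all _ fun ω => sub_add_cancel (f ω) c)

section Drift

variable {p : ℝ≥0} {T : ℝ} {d : ℕ} {b : Drift p T d}

/-- The drift is `K`-Lipschitz for the sum of the two distances; the second one is bounded by a real
number `D`, so that the inequality can be stated for real numbers. -/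
def LipschitzDrift (b : Drift p T d) (K : ℝ) : Prop :=
  ∀ t x x' (μ μ' : FiniteMoment p (Space d)) (D : ℝ), 0 ≤ D →
    wasserstein p μ.1 μ'.1 ≤ ENNReal.ofReal D → ‖b t x μ - b t x' μ'‖ ≤ K * (‖x - x'‖ + D)

theorem DriftAssumption.exists_lipschitzDrift (hp : 1 ≤ p) (hb : DriftAssumption b) :
    ∃ K : ℝ, 0 < K ∧ LipschitzDrift b K := by
  obtain ⟨K, hK⟩ := hb.lipschitz
  have hp1 : (1 : ℝ) ≤ p := by exact_mod_cast hp
  have hp0 : (0 : ℝ) < p := zero_lt_one.trans_le hp1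
  -- The summand `1` only makes the constant positive.
  refine ⟨(K : ℝ) ^ (1 / (p : ℝ)) + 1, by positivity, fun t x x' μ μ' D hD hW => ?_⟩
  have h1 : ‖b t x μ - b t x' μ'‖ₑ ^ (p : ℝ) ≤
      ((K : ℝ≥0∞) ^ (1 / (p : ℝ)) * (‖x - x'‖ₑ + ENNReal.ofReal D)) ^ (p : ℝ) := by
    rw [ENNReal.mul_rpow_of_nonneg _ _ hp0.le, ← ENNReal.rpow_mul, one_div_mul_cancel hp0.ne',
      ENNReal.rpow_one]
    refine (hK t x x' μ μ').trans ?_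
    gcongr
    refine le_trans ?_ (ENNReal.add_rpow_le_rpow_add _ _ hp1)
    gcongr
  have h2 := (ENNReal.rpow_le_rpow_iff hp0).1 h1
  have h3 : ‖b t x μ - b t x' μ'‖ ≤ (K : ℝ) ^ (1 / (p : ℝ)) * (‖x - x'‖ + D) := by
    have h4 := ENNReal.toReal_mono (by
      refine ENNReal.mul_ne_top (ENNReal.rpow_ne_top_of_nonneg (by positivity)
        ENNReal.coe_ne_top) (by simp)) h2
    rwa [ENNReal.toReal_mul, ENNReal.toReal_add (by simp) (by simp), toReal_enorm, toReal_enorm,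
      ENNReal.toReal_ofReal hD, ← ENNReal.toReal_rpow, ENNReal.coe_toReal] at h4
  refine h3.trans ?_
  gcongr
  exact le_add_of_nonneg_right zero_le_one

/-- The map `(s, r) ↦ b s (x r) (μ_r)` is measurable in `s` and continuous in `r`, hence jointly
measurable, and its restriction to the diagonal is the drift along the path. -/
theorem measurable_drift_marginal (hp : 1 ≤ p) {K : ℝ} (hb : DriftAssumption b)
    (hK : LipschitzDrift b K) (μ : FiniteMoment p (PathSpace T d))
    (x : PathSpace T d) : Measurable fun s => b s (x s) (marginal μ s) := by
  have hu : ∀ s, Continuous fun r => b s (x r) (marginal μ r) := by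
    intro s
    refine continuous_iff_continuousAt.2 fun r₀ => ?_
    have hW := tendsto_wasserstein_marginal hp μ r₀
    have hfin : ∀ᶠ r in 𝓝 r₀, wasserstein p (marginal μ r).1 (marginal μ r₀).1 ≠ ∞ :=
      (hW.eventually (gt_mem_nhds ENNReal.zero_lt_top)).mono fun r hr => ne_of_lt hr
    have hlim : Tendsto (fun r => K * (‖x r - x r₀‖ +
        (wasserstein p (marginal μ r).1 (marginal μ r₀).1).toReal)) (𝓝 r₀) (𝓝 0) := by
      have hx : Tendsto (fun r => ‖x r - x r₀‖) (𝓝 r₀) (𝓝 0) := by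
        have hc : Continuous fun r => ‖x r - x r₀‖ := by fun_prop
        simpa using hc.tendsto r₀
      have hw := (ENNReal.tendsto_toReal ENNReal.zero_ne_top).comp hW
      simpa using (hx.add hw).const_mul K
    refine tendsto_iff_norm_sub_tendsto_zero.2
      (squeeze_zero' (Eventually.of_forall fun _ => norm_nonneg _) ?_ hlim)
    filter_upwards [hfin] with r hr
    exact hK s _ _ _ _ _ ENNReal.toReal_nonneg (ENNReal.ofReal_toReal hr).ge
  exact (measurable_uncurry_of_continuous_of_measurable hu
    fun r => hb.measurable (x r) (marginal μ r)).comp (measurable_id.prodMk measurable_id)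

theorem integrable_drift_marginal (hp : 1 ≤ p) {K : ℝ} (hK0 : 0 ≤ K) (hb : DriftAssumption b)
    (hK : LipschitzDrift b K) (μ : FiniteMoment p (PathSpace T d))
    (x : PathSpace T d) :
    Integrable (fun s => b s (x s) (marginal μ s)) (timeMeasure T) := by
  obtain ⟨x₀, m₀, h₀⟩ := hb.integrable
  set R := eLpNorm id (p : ℝ≥0∞) μ.1 + eLpNorm id (p : ℝ≥0∞) m₀.1 with hR
  have hRtop : R ≠ ∞ :=
    ENNReal.add_ne_top.2 ⟨(memLp_id_of_finiteMoment hp μ).2.ne,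
      (memLp_id_of_finiteMoment hp m₀).2.ne⟩
  refine Integrable.mono' (h₀.norm.add (integrable_const (K * (‖x‖ + ‖x₀‖ + R.toReal))))
    (measurable_drift_marginal hp hb hK μ x).aestronglyMeasurable
    (Eventually.of_forall fun s => ?_)
  have hW : wasserstein p (marginal μ s).1 m₀.1 ≤ ENNReal.ofReal R.toReal := by
    rw [ENNReal.ofReal_toReal hRtop]
    exact (wasserstein_le_add hp _ _).trans (add_le_add (eLpNorm_marginal_le μ s) le_rfl)
  calc ‖b s (x s) (marginal μ s)‖
      ≤ ‖b s x₀ m₀‖ + ‖b s (x s) (marginal μ s) - b s x₀ m₀‖ := norm_le_insert' _ _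
    _ ≤ ‖b s x₀ m₀‖ + K * (‖x s - x₀‖ + R.toReal) := by
        gcongr
        exact hK s _ _ _ _ _ ENNReal.toReal_nonneg hW
    _ ≤ ‖b s x₀ m₀‖ + K * (‖x‖ + ‖x₀‖ + R.toReal) := by
        gcongr
        exact (norm_sub_le _ _).trans (add_le_add (x.norm_coe_le_norm s) le_rfl)

/-- Stability of single paths, in the data and in the flow of measures. The rate `4 K` of the weight
is chosen so that the term containing the path itself can be absorbed on the left. -/
theorem IsPathSolution.norm_expWeight_sub_le {K : ℝ} (hK0 : 0 < K)
    (hK : LipschitzDrift b K) {m m' : Icc (0 : ℝ) T → FiniteMoment p (Space d)}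
    {x₀ x₀' : Space d} {γ γ' x x' : PathSpace T d} (hx : IsPathSolution b m x₀ γ x)
    (hx' : IsPathSolution b m' x₀' γ' x') {D : ℝ} (hD : 0 ≤ D)
    (hm : ∀ s, wasserstein p (m s).1 (m' s).1 ≤
      ENNReal.ofReal (Real.exp (4 * K * s) * D)) :
    ‖expWeight (4 * K) (x - x')‖ ≤ 4 / 3 * (‖x₀ - x₀'‖ + ‖γ - γ'‖) + D / 3 := by
  have h := McKeanVlasov.norm_expWeight_sub_le (l := 4 * K)
    (M := K * (‖expWeight (4 * K) (x - x')‖ + D))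
    (by positivity) (by positivity) hx.1 hx'.1 hx.2 hx'.2 fun s => by
      refine (hK s _ _ _ _ _ (by positivity) (hm s)).trans ?_
      have h := norm_apply_le_exp_mul (4 * K) (x - x') s
      rw [ContinuousMap.sub_apply] at h
      calc _ ≤ K * (Real.exp (4 * K * s) * ‖expWeight (4 * K) (x - x')‖ +
            Real.exp (4 * K * s) * D) := by gcongr
        _ = _ := by ring
  have h2 : K * (‖expWeight (4 * K) (x - x')‖ + D) / (4 * K) =
      (‖expWeight (4 * K) (x - x')‖ + D) / 4 := by field_simp
  rw [h2] at h
  linarith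

/-- Stability of single paths driven by the same flow of measures. -/
theorem IsPathSolution.norm_sub_le (hp : 1 ≤ p) {K : ℝ} (hK0 : 0 < K)
    (hK : LipschitzDrift b K) {m : Icc (0 : ℝ) T → FiniteMoment p (Space d)}
    {x₀ x₀' : Space d} {γ γ' x x' : PathSpace T d} (hx : IsPathSolution b m x₀ γ x)
    (hx' : IsPathSolution b m x₀' γ' x') :
    ‖x - x'‖ ≤ Real.exp (4 * K * T) * (4 / 3 * (‖x₀ - x₀'‖ + ‖γ - γ'‖)) := by
  have h := hx.norm_expWeight_sub_le hK0 hK hx' le_rfl fun s => by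
    simp [wasserstein_self hp]
  rw [zero_div, add_zero] at h
  exact (norm_le_exp_mul_norm_expWeight (by positivity) _).trans
    (mul_le_mul_of_nonneg_left h (Real.exp_pos _).le)

theorem IsPathSolution.unique (hp : 1 ≤ p) {K : ℝ} (hK0 : 0 < K)
    (hK : LipschitzDrift b K) {m : Icc (0 : ℝ) T → FiniteMoment p (Space d)}
    {x₀ : Space d} {γ x x' : PathSpace T d} (hx : IsPathSolution b m x₀ γ x)
    (hx' : IsPathSolution b m x₀ γ x') : x = x' := by
  have h := hx.norm_sub_le hp hK0 hK hx'
  simp only [sub_self, norm_zero, add_zero, mul_zero] at h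
  exact sub_eq_zero.1 (norm_le_zero_iff.1 h)

theorem isPathSolution_solutionMap (hT : 0 ≤ T) (hp : 1 ≤ p) {K : ℝ} (hK0 : 0 < K)
    (hb : DriftAssumption b) (hK : LipschitzDrift b K) (μ : FiniteMoment p (PathSpace T d))
    (z : Space d × PathSpace T d) :
    IsPathSolution b (marginal μ) z.1 z.2 (solutionMap b μ z) := by
  have hex : ∃ x, IsPathSolution b (marginal μ) z.1 z.2 x := by
    have hint := integrable_drift_marginal hp hK0.le hb hK μ
    obtain ⟨x, hx⟩ := exists_integral_equation hT (B := fun s y => b s y (marginal μ s)) hK0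
      (fun s x y => by
        simpa using hK s x y (marginal μ s) (marginal μ s) 0 le_rfl
          (by simp [wasserstein_self hp])) hint z.1 z.2
    exact ⟨x, hint x, hx⟩
  rw [solutionMap, dif_pos hex]
  exact hex.choose_spec

/-- The factor `8 / 3` is twice `4 / 3`, because each component of `z - z'` is bounded by the
maximum norm. -/
theorem norm_solutionMap_sub_le (hT : 0 ≤ T) (hp : 1 ≤ p) {K : ℝ} (hK0 : 0 < K)
    (hb : DriftAssumption b) (hK : LipschitzDrift b K) (μ : FiniteMoment p (PathSpace T d))
    (z z' : Space d × PathSpace T d) :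
    ‖solutionMap b μ z - solutionMap b μ z'‖ ≤ Real.exp (4 * K * T) * (8 / 3) * ‖z - z'‖ := by
  refine ((isPathSolution_solutionMap hT hp hK0 hb hK μ z).norm_sub_le hp hK0 hK
    (isPathSolution_solutionMap hT hp hK0 hb hK μ z')).trans ?_
  calc _ ≤ Real.exp (4 * K * T) * (4 / 3 * (‖z - z'‖ + ‖z - z'‖)) := by
        gcongr
        · exact norm_fst_le (z - z')
        · exact norm_snd_le (z - z')
    _ = _ := by ring

theorem continuous_solutionMap (hT : 0 ≤ T) (hp : 1 ≤ p) {K : ℝ} (hK0 : 0 < K)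
    (hb : DriftAssumption b) (hK : LipschitzDrift b K) (μ : FiniteMoment p (PathSpace T d)) :
    Continuous (solutionMap b μ) :=
  (LipschitzWith.of_dist_le_mul (K := ⟨Real.exp (4 * K * T) * (8 / 3), by positivity⟩)
    fun z z' => by
      rw [dist_eq_norm, dist_eq_norm]
      exact norm_solutionMap_sub_le hT hp hK0 hb hK μ z z').continuous

theorem memLp_solutionMap (hT : 0 ≤ T) (hp : 1 ≤ p) {K : ℝ} (hK0 : 0 < K)
    (hb : DriftAssumption b) (hK : LipschitzDrift b K) (μ : FiniteMoment p (PathSpace T d))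
    {Ω : Type*} [MeasurableSpace Ω] {P : Measure Ω} [IsFiniteMeasure P]
    {Z : Ω → Space d × PathSpace T d} (hZ : MemLp Z (p : ℝ≥0∞) P) :
    MemLp (fun ω => solutionMap b μ (Z ω)) (p : ℝ≥0∞) P := by
  refine memLp_of_norm_sub_const_le
    ((continuous_solutionMap hT hp hK0 hb hK μ).comp_aestronglyMeasurable hZ.1) hZ
    (c := solutionMap b μ 0) (C := Real.exp (4 * K * T) * (8 / 3)) (ae_of_all _ fun ω => ?_)
  have h := norm_solutionMap_sub_le hT hp hK0 hb hK μ (Z ω) 0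
  rwa [sub_zero] at h

end Drift

/-! ### Stability in `L^p` and the fixed point -/

section FixedPoint

variable {p : ℝ≥0} {T : ℝ} {d : ℕ} {b : Drift p T d} {Ω : Type*} [MeasurableSpace Ω]
  {P : Measure Ω}

theorem marginal_eq_map {μ : FiniteMoment p (PathSpace T d)} {X : Ω → PathSpace T d}
    (hX : AEMeasurable X P) (hμ : μ.1 = P.map X) (s : Icc (0 : ℝ) T) :
    (marginal μ s).1 = P.map fun ω => X ω s := by
  change μ.1.map (fun γ => γ s) = _
  rw [hμ, AEMeasurable.map_map_of_aemeasurable (measurable_eval s).aemeasurable hX]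
  rfl

theorem wasserstein_marginal_le (hp : 1 ≤ p) (l : ℝ) {μ μ' : FiniteMoment p (PathSpace T d)}
    {X X' : Ω → PathSpace T d} (hX : AEMeasurable X P) (hX' : AEMeasurable X' P)
    (hμ : μ.1 = P.map X) (hμ' : μ'.1 = P.map X') (s : Icc (0 : ℝ) T) :
    wasserstein p (marginal μ s).1 (marginal μ' s).1 ≤ ENNReal.ofReal (Real.exp (l * s)) *
      eLpNorm (fun ω => expWeight l (X ω - X' ω)) (p : ℝ≥0∞) P := by
  rw [marginal_eq_map hX hμ, marginal_eq_map hX' hμ']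
  refine (wasserstein_map_le hp ((measurable_eval s).comp_aemeasurable hX)
    ((measurable_eval s).comp_aemeasurable hX')).trans
    (eLpNorm_le_mul_eLpNorm_of_ae_le_mul (ae_of_all _ fun ω => ?_) _)
  exact norm_apply_le_exp_mul l (X ω - X' ω) s

/-- The key estimate: solutions on a common probability space depend Lipschitz continuously, in
`L^p`, on the input. The distance of the laws is bounded by the weighted `L^p` distance of the
solutions themselves, with a factor that allows it to be absorbed. -/
theorem eLpNorm_sub_le_of_isPathSolution [IsProbabilityMeasure P] (hp : 1 ≤ p) {K : ℝ}
    (hK0 : 0 < K) (hK : LipschitzDrift b K) {μ μ' : FiniteMoment p (PathSpace T d)}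
    {Z Z' : Ω → Space d × PathSpace T d} {X X' : Ω → PathSpace T d}
    (hZ : MemLp Z (p : ℝ≥0∞) P) (hZ' : MemLp Z' (p : ℝ≥0∞) P)
    (hX : MemLp X (p : ℝ≥0∞) P) (hX' : MemLp X' (p : ℝ≥0∞) P)
    (hμ : μ.1 = P.map X) (hμ' : μ'.1 = P.map X')
    (hs : ∀ᵐ ω ∂P, IsPathSolution b (marginal μ) (Z ω).1 (Z ω).2 (X ω))
    (hs' : ∀ᵐ ω ∂P, IsPathSolution b (marginal μ') (Z' ω).1 (Z' ω).2 (X' ω)) :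
    eLpNorm (X - X') (p : ℝ≥0∞) P ≤
      ENNReal.ofReal (Real.exp (4 * K * T) * 4) * eLpNorm (Z - Z') (p : ℝ≥0∞) P := by
  have hp1 : (1 : ℝ≥0∞) ≤ p := by exact_mod_cast hp
  set N := eLpNorm (fun ω => expWeight (4 * K) (X ω - X' ω)) (p : ℝ≥0∞) P with hN
  have hNtop : N ≠ ∞ :=
    ((expWeight (T := T) (d := d) (4 * K)).comp_memLp' (hX.sub hX')).2.ne
  have hAtop : eLpNorm (Z - Z') (p : ℝ≥0∞) P ≠ ∞ := (hZ.sub hZ').2.ne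
  set A := (eLpNorm (Z - Z') (p : ℝ≥0∞) P).toReal with hA
  have hpath : ∀ᵐ ω ∂P, ‖expWeight (4 * K) (X ω - X' ω)‖ ≤
      8 / 3 * ‖(Z - Z') ω‖ + N.toReal / 3 := by
    filter_upwards [hs, hs'] with ω h h'
    refine (h.norm_expWeight_sub_le hK0 hK h' (D := N.toReal) ENNReal.toReal_nonneg
      fun s => ?_).trans ?_
    · refine (wasserstein_marginal_le hp (4 * K) hX.1.aemeasurable hX'.1.aemeasurable hμ hμ'
        s).trans ?_
      rw [ENNReal.ofReal_mul (Real.exp_pos _).le, ENNReal.ofReal_toReal hNtop]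
    · have h1 := norm_fst_le ((Z - Z') ω)
      have h2 := norm_snd_le ((Z - Z') ω)
      change ‖(Z ω).1 - (Z' ω).1‖ ≤ _ at h1
      change ‖(Z ω).2 - (Z' ω).2‖ ≤ _ at h2
      linarith
  have hle : N ≤ ENNReal.ofReal (8 / 3 * A + N.toReal / 3) := by
    have hZn : AEStronglyMeasurable (fun ω => 8 / 3 * ‖(Z - Z') ω‖) P :=
      (hZ.sub hZ').1.norm.const_mul _
    calc N ≤ eLpNorm (fun ω => 8 / 3 * ‖(Z - Z') ω‖ + N.toReal / 3) (p : ℝ≥0∞) P :=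
          eLpNorm_mono_ae_real hpath
      _ ≤ eLpNorm (fun ω => 8 / 3 * ‖(Z - Z') ω‖) (p : ℝ≥0∞) P +
            eLpNorm (fun _ => N.toReal / 3) (p : ℝ≥0∞) P :=
          eLpNorm_add_le hZn aestronglyMeasurable_const hp1
      _ ≤ ENNReal.ofReal (8 / 3) * eLpNorm (Z - Z') (p : ℝ≥0∞) P +
            ENNReal.ofReal (N.toReal / 3) := by
          gcongr
          · refine eLpNorm_le_mul_eLpNorm_of_ae_le_mul (ae_of_all _ fun ω => ?_) _
            rw [norm_mul, norm_norm, Real.norm_of_nonneg (by norm_num)]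
          · rw [eLpNorm_const _ (zero_lt_one.trans_le hp1).ne' (IsProbabilityMeasure.ne_zero P)]
            simp [Real.enorm_of_nonneg (div_nonneg ENNReal.toReal_nonneg zero_le_three)]
      _ = ENNReal.ofReal (8 / 3 * A + N.toReal / 3) := by
          rw [ENNReal.ofReal_add (by positivity) (by positivity), ENNReal.ofReal_mul (by norm_num),
            hA, ENNReal.ofReal_toReal hAtop]
  have hreal : N.toReal ≤ 8 / 3 * A + N.toReal / 3 := by
    have h := ENNReal.toReal_mono ENNReal.ofReal_ne_top hle
    rwa [ENNReal.toReal_ofReal (by positivity)] at h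
  have hN4 : N ≤ ENNReal.ofReal 4 * eLpNorm (Z - Z') (p : ℝ≥0∞) P := by
    rw [← ENNReal.ofReal_toReal hNtop, ← ENNReal.ofReal_toReal hAtop,
      ← ENNReal.ofReal_mul (by norm_num)]
    exact ENNReal.ofReal_le_ofReal (by linarith)
  have hT : ∀ ω, ‖(X - X') ω‖ ≤ Real.exp (4 * K * T) * ‖expWeight (4 * K) (X ω - X' ω)‖ :=
    fun ω => norm_le_exp_mul_norm_expWeight (by positivity) _
  calc eLpNorm (X - X') (p : ℝ≥0∞) P ≤ ENNReal.ofReal (Real.exp (4 * K * T)) * N :=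
        eLpNorm_le_mul_eLpNorm_of_ae_le_mul (ae_of_all _ hT) _
    _ ≤ ENNReal.ofReal (Real.exp (4 * K * T)) *
          (ENNReal.ofReal 4 * eLpNorm (Z - Z') (p : ℝ≥0∞) P) := by gcongr
    _ = _ := by rw [ENNReal.ofReal_mul (Real.exp_pos _).le, mul_assoc (ENNReal.ofReal _)]

/-- Existence of a fixed point of `Φ(ν, ·)`. On the canonical space `(ℝ^d × C_T, ν)` the map
`X ↦ S^{ℒ(X)}` is a contraction of the complete space `L^p(ν; C_T)` with the weighted norm, and the
law of its fixed point is a fixed point of `Φ(ν, ·)`. This avoids completeness of `𝒲_p`. -/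
theorem exists_lawMap_eq (hT : 0 ≤ T) (hp : 1 ≤ p) {K : ℝ} (hK0 : 0 < K)
    (hb : DriftAssumption b) (hK : LipschitzDrift b K)
    (ν : FiniteMoment p (Space d × PathSpace T d)) :
    ∃ μ : FiniteMoment p (PathSpace T d), lawMap b ν μ = μ.1 := by
  have := ν.2.1
  have hp1 : (1 : ℝ≥0∞) ≤ p := by exact_mod_cast hp
  have : Fact ((1 : ℝ≥0∞) ≤ p) := ⟨hp1⟩
  have hid := memLp_id_of_finiteMoment hp ν
  let L (l : ℝ) : PathSpace T d →L[ℝ] PathSpace T d := expWeight l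
  have hX (Y : Lp (PathSpace T d) (p : ℝ≥0∞) ν.1) :
      MemLp (fun z => L (-(4 * K)) (Y z)) (p : ℝ≥0∞) ν.1 :=
    (L (-(4 * K))).comp_memLp' (Lp.memLp Y)
  have hS (μ : FiniteMoment p (PathSpace T d)) :
      MemLp (fun z => L (4 * K) (solutionMap b μ z)) (p : ℝ≥0∞) ν.1 :=
    (L (4 * K)).comp_memLp' (memLp_solutionMap hT hp hK0 hb hK μ hid)
  let F : Lp (PathSpace T d) (p : ℝ≥0∞) ν.1 → Lp (PathSpace T d) (p : ℝ≥0∞) ν.1 :=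
    fun Y => (hS (law (hX Y))).toLp _
  have hF : ContractingWith (1 / 3) F := by
    refine ⟨by rw [← NNReal.coe_lt_coe]; norm_num, fun Y Y' => ?_⟩
    have hdist : ∀ z, ‖((fun z => L (4 * K) (solutionMap b (law (hX Y)) z)) -
        fun z => L (4 * K) (solutionMap b (law (hX Y')) z)) z‖ ≤ (edist Y Y').toReal / 3 := by
      intro z
      have h := (isPathSolution_solutionMap hT hp hK0 hb hK (law (hX Y)) z).norm_expWeight_sub_le
        hK0 hK (isPathSolution_solutionMap hT hp hK0 hb hK (law (hX Y')) z)
        (D := (edist Y Y').toReal) ENNReal.toReal_nonneg fun s => by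
          refine (wasserstein_marginal_le hp (4 * K) (hX Y).1.aemeasurable
            (hX Y').1.aemeasurable rfl rfl s).trans (le_of_eq ?_)
          rw [ENNReal.ofReal_mul (Real.exp_pos _).le, ENNReal.ofReal_toReal (edist_ne_top _ _),
            Lp.edist_def]
          congr 2
          funext z
          rw [← map_sub, Pi.sub_apply]
          exact expWeight_expWeight_neg _ _
      rw [sub_self, sub_self, norm_zero, norm_zero, add_zero, mul_zero, zero_add, map_sub] at h
      exact h
    change edist ((hS (law (hX Y))).toLp _) ((hS (law (hX Y'))).toLp _) ≤ _
    rw [Lp.edist_toLp_toLp]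
    calc _ ≤ eLpNorm (fun _ : Space d × PathSpace T d => (edist Y Y').toReal / 3) p ν.1 :=
          eLpNorm_mono_real hdist
      _ = ENNReal.ofReal ((edist Y Y').toReal / 3) := by
          rw [eLpNorm_const _ (zero_lt_one.trans_le hp1).ne' (IsProbabilityMeasure.ne_zero ν.1)]
          simp [Real.enorm_of_nonneg (div_nonneg ENNReal.toReal_nonneg zero_le_three)]
      _ = _ := by
          rw [div_eq_inv_mul, ENNReal.ofReal_mul (by norm_num),
            ENNReal.ofReal_toReal (edist_ne_top _ _), ENNReal.ofReal_inv_of_pos zero_lt_three]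
          simp
  obtain ⟨Y, hY, -⟩ := hF.exists_fixedPoint 0 (edist_ne_top _ _)
  refine ⟨law (hX Y), ?_⟩
  change ν.1.map _ = ν.1.map _
  refine Measure.map_congr ?_
  have h1 : Y =ᵐ[ν.1] fun z => L (4 * K) (solutionMap b (law (hX Y)) z) := by
    have h := (hS (law (hX Y))).coeFn_toLp
    change F Y =ᵐ[ν.1] _ at h
    rwa [hY.eq] at h
  filter_upwards [h1] with z hz
  rw [hz]
  exact (expWeight_neg_expWeight _ _).symm

end FixedPoint

/-! ### Solutions of the McKean-Vlasov equation -/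

theorem eLpNorm_sub_self_eq_zero {Ω E : Type*} [MeasurableSpace Ω] [NormedAddCommGroup E]
    (f : Ω → E) (q : ℝ≥0∞) (P : Measure Ω) : eLpNorm (f - f) q P = 0 := by
  simp

section Solution

variable {p : ℝ≥0} {T : ℝ} {d : ℕ} {b : Drift p T d}

/-- The law of `S^μ(Z)`, where `Z` has law `ν` and `μ` is a fixed point of `Φ(ν, ·)`, is `μ`. -/
theorem map_solutionMap_eq (hT : 0 ≤ T) (hp : 1 ≤ p) {K : ℝ} (hK0 : 0 < K)
    (hb : DriftAssumption b) (hK : LipschitzDrift b K) {Ω : Type*} [MeasurableSpace Ω]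
    {P : Measure Ω} {Z : Ω → Space d × PathSpace T d} (hZ : AEMeasurable Z P)
    {ν : FiniteMoment p (Space d × PathSpace T d)} {μ : FiniteMoment p (PathSpace T d)}
    (hν : P.map Z = ν.1) (hμ : lawMap b ν μ = μ.1) :
    P.map (fun ω => solutionMap b μ (Z ω)) = μ.1 := by
  rw [← hμ, lawMap, ← hν, AEMeasurable.map_map_of_aemeasurable
    (continuous_solutionMap hT hp hK0 hb hK μ).measurable.aemeasurable hZ]
  rfl

theorem eq_of_map_solutionMap_eq (hT : 0 ≤ T) (hp : 1 ≤ p) {K : ℝ} (hK0 : 0 < K)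
    (hb : DriftAssumption b) (hK : LipschitzDrift b K) {Ω : Type*} [MeasurableSpace Ω]
    {P : Measure Ω} [IsProbabilityMeasure P] {Z : Ω → Space d × PathSpace T d}
    (hZ : MemLp Z (p : ℝ≥0∞) P) {μ μ' : FiniteMoment p (PathSpace T d)}
    (hμ : P.map (fun ω => solutionMap b μ (Z ω)) = μ.1)
    (hμ' : P.map (fun ω => solutionMap b μ' (Z ω)) = μ'.1) : μ = μ' := by
  have hp0 : (p : ℝ≥0∞) ≠ 0 := by exact_mod_cast (zero_lt_one.trans_le hp).ne'
  have hX := memLp_solutionMap hT hp hK0 hb hK μ hZ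
  have hX' := memLp_solutionMap hT hp hK0 hb hK μ' hZ
  have h := eLpNorm_sub_le_of_isPathSolution hp hK0 hK hZ hZ hX hX' hμ.symm hμ'.symm
    (ae_of_all _ fun ω => isPathSolution_solutionMap hT hp hK0 hb hK μ (Z ω))
    (ae_of_all _ fun ω => isPathSolution_solutionMap hT hp hK0 hb hK μ' (Z ω))
  rw [eLpNorm_sub_self_eq_zero, mul_zero, nonpos_iff_eq_zero] at h
  have hae := (eLpNorm_eq_zero_iff (hX.sub hX').1 hp0).1 h
  refine Subtype.ext (hμ.symm.trans (Eq.trans (Measure.map_congr ?_) hμ'))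
  filter_upwards [hae] with ω hω
  exact sub_eq_zero.1 hω

theorem eq_of_lawMap_eq (hT : 0 ≤ T) (hp : 1 ≤ p) {K : ℝ} (hK0 : 0 < K)
    (hb : DriftAssumption b) (hK : LipschitzDrift b K)
    {ν : FiniteMoment p (Space d × PathSpace T d)} {μ μ' : FiniteMoment p (PathSpace T d)}
    (hμ : lawMap b ν μ = μ.1) (hμ' : lawMap b ν μ' = μ'.1) : μ = μ' := by
  have := ν.2.1
  exact eq_of_map_solutionMap_eq hT hp hK0 hb hK (memLp_id_of_finiteMoment hp ν) hμ hμ'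

/-- Fixed points depend Lipschitz continuously on the input law: every coupling of `ν` and `ν'` is a
probability space carrying inputs with these laws, to which the `L^p` estimate applies. -/
theorem wasserstein_le_of_lawMap_eq (hT : 0 ≤ T) (hp : 1 ≤ p) {K : ℝ} (hK0 : 0 < K)
    (hb : DriftAssumption b) (hK : LipschitzDrift b K)
    {ν ν' : FiniteMoment p (Space d × PathSpace T d)} {μ μ' : FiniteMoment p (PathSpace T d)}
    (hμ : lawMap b ν μ = μ.1) (hμ' : lawMap b ν' μ' = μ'.1) :
    wasserstein p μ.1 μ'.1 ≤
      (Real.exp (4 * K * T) * 4).toNNReal * wasserstein p ν.1 ν'.1 := by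
  refine le_mul_wasserstein hp (Real.toNNReal_pos.2 (by positivity)) fun m hm => ?_
  have hν := ν.2.1
  have hm1 : IsProbabilityMeasure (m.map Prod.fst) := by rwa [hm.1]
  have : IsProbabilityMeasure m := Measure.isProbabilityMeasure_of_map Prod.fst
  have hZ : MemLp Prod.fst (p : ℝ≥0∞) m := by
    have h := memLp_id_of_finiteMoment hp ν
    rw [← hm.1] at h
    exact (memLp_map_measure_iff h.1 measurable_fst.aemeasurable).1 h
  have hZ' : MemLp Prod.snd (p : ℝ≥0∞) m := by
    have h := memLp_id_of_finiteMoment hp ν'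
    rw [← hm.2] at h
    exact (memLp_map_measure_iff h.1 measurable_snd.aemeasurable).1 h
  have hX := memLp_solutionMap hT hp hK0 hb hK μ hZ
  have hX' := memLp_solutionMap hT hp hK0 hb hK μ' hZ'
  have hlaw := map_solutionMap_eq hT hp hK0 hb hK measurable_fst.aemeasurable hm.1 hμ
  have hlaw' := map_solutionMap_eq hT hp hK0 hb hK measurable_snd.aemeasurable hm.2 hμ'
  have h := eLpNorm_sub_le_of_isPathSolution hp hK0 hK hZ hZ' hX hX' hlaw.symm hlaw'.symm
    (ae_of_all _ fun z => isPathSolution_solutionMap hT hp hK0 hb hK μ z.1)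
    (ae_of_all _ fun z => isPathSolution_solutionMap hT hp hK0 hb hK μ' z.2)
  have hW := wasserstein_map_le hp hX.1.aemeasurable hX'.1.aemeasurable
  rw [hlaw, hlaw'] at hW
  exact hW.trans h

/-- The paths of a solution have a `p`-th moment in the supremum norm, although only the moments of
the time marginals are assumed: almost every path is compared with one fixed path `X(ω₀)`, which
solves the equation with the same flow of laws. -/
theorem IsSolution.memLp (hp : 1 ≤ p) {K : ℝ} (hK0 : 0 < K) (hK : LipschitzDrift b K)
    {Ω : Type*} [MeasurableSpace Ω] {P : Measure Ω} [IsProbabilityMeasure P] {ζ : Ω → Space d}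
    {W X : Ω → PathSpace T d} (hZ : MemLp (fun ω => (ζ ω, W ω)) (p : ℝ≥0∞) P)
    (hX : IsSolution b P ζ W X) : MemLp X (p : ℝ≥0∞) P := by
  obtain ⟨hXm, hmom, hsol⟩ := hX
  obtain ⟨ω₀, h₀⟩ := hsol.exists
  refine memLp_of_norm_sub_const_le hXm.aestronglyMeasurable (hZ.sub (memLp_const (ζ ω₀, W ω₀)))
    (c := X ω₀) (C := Real.exp (4 * K * T) * (8 / 3)) ?_
  filter_upwards [hsol] with ω h
  refine (h.norm_sub_le hp hK0 hK h₀).trans ?_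
  have h1 := norm_fst_le ((ζ ω, W ω) - (ζ ω₀, W ω₀))
  have h2 := norm_snd_le ((ζ ω, W ω) - (ζ ω₀, W ω₀))
  rw [mul_assoc (Real.exp _)]
  refine mul_le_mul_of_nonneg_left ?_ (Real.exp_pos _).le
  change ‖ζ ω - ζ ω₀‖ ≤ _ at h1
  change ‖W ω - W ω₀‖ ≤ _ at h2
  change _ ≤ 8 / 3 * ‖(ζ ω, W ω) - (ζ ω₀, W ω₀)‖
  linarith

theorem IsSolution.isPathSolution_marginal {Ω : Type*} [MeasurableSpace Ω] {P : Measure Ω}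
    [IsProbabilityMeasure P] {ζ : Ω → Space d} {W X : Ω → PathSpace T d}
    (hX : IsSolution b P ζ W X) {μ : FiniteMoment p (PathSpace T d)} (hμ : μ.1 = P.map X) :
    ∀ᵐ ω ∂P, IsPathSolution b (marginal μ) (ζ ω) (W ω) (X ω) := by
  obtain ⟨hXm, hmom, hsol⟩ := hX
  have hflow : (fun s => law (hmom s)) = marginal μ := by
    funext s
    exact Subtype.ext (marginal_eq_map hXm hμ s).symm
  rwa [hflow] at hsol

/-- The law of a solution is a fixed point of `Φ(ν, ·)`, hence equal to `μ` if `μ` is one, and the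
solution is its own input transformed by the solution map. -/
theorem IsSolution.map_eq_and_ae_eq (hT : 0 ≤ T) (hp : 1 ≤ p) {K : ℝ} (hK0 : 0 < K)
    (hb : DriftAssumption b) (hK : LipschitzDrift b K) {Ω : Type*} [MeasurableSpace Ω]
    {P : Measure Ω} [IsProbabilityMeasure P] {ζ : Ω → Space d} {W X : Ω → PathSpace T d}
    (hZ : MemLp (fun ω => (ζ ω, W ω)) (p : ℝ≥0∞) P) (hX : IsSolution b P ζ W X)
    {μ : FiniteMoment p (PathSpace T d)} (hμ : lawMap b (law hZ) μ = μ.1) :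
    P.map X = μ.1 ∧ X =ᵐ[P] fun ω => solutionMap b μ (ζ ω, W ω) := by
  let μX := law (hX.memLp hp hK0 hK hZ)
  have hae : X =ᵐ[P] fun ω => solutionMap b μX (ζ ω, W ω) := by
    filter_upwards [hX.isPathSolution_marginal (μ := μX) rfl] with ω h
    exact h.unique hp hK0 hK (isPathSolution_solutionMap hT hp hK0 hb hK μX (ζ ω, W ω))
  have hfix : lawMap b (law hZ) μX = μX.1 := by
    change (P.map fun ω => (ζ ω, W ω)).map (solutionMap b μX) = P.map X
    rw [AEMeasurable.map_map_of_aemeasurable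
      (continuous_solutionMap hT hp hK0 hb hK μX).measurable.aemeasurable hZ.1.aemeasurable]
    exact (Measure.map_congr hae).symm
  have heq : μX = μ := eq_of_lawMap_eq hT hp hK0 hb hK hfix hμ
  rw [← heq]
  exact ⟨rfl, hae⟩

/-- Conversely, a fixed point of `Φ(ν, ·)` gives a solution. -/
theorem isSolution_solutionMap (hT : 0 ≤ T) (hp : 1 ≤ p) {K : ℝ} (hK0 : 0 < K)
    (hb : DriftAssumption b) (hK : LipschitzDrift b K) {Ω : Type*} [MeasurableSpace Ω]
    {P : Measure Ω} [IsProbabilityMeasure P] {ζ : Ω → Space d} {W : Ω → PathSpace T d}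
    (hZ : MemLp (fun ω => (ζ ω, W ω)) (p : ℝ≥0∞) P) {μ : FiniteMoment p (PathSpace T d)}
    (hμ : lawMap b (law hZ) μ = μ.1) :
    IsSolution b P ζ W fun ω => solutionMap b μ (ζ ω, W ω) := by
  have hX := memLp_solutionMap hT hp hK0 hb hK μ hZ
  have hlaw := map_solutionMap_eq hT hp hK0 hb hK hZ.1.aemeasurable rfl hμ
  have hmom : ∀ s, MemLp (fun ω => solutionMap b μ (ζ ω, W ω) s) (p : ℝ≥0∞) P := fun s =>
    hX.mono ((measurable_eval s).comp_aemeasurable hX.1.aemeasurable).aestronglyMeasurable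
      (ae_of_all _ fun ω => (solutionMap b μ (ζ ω, W ω)).norm_coe_le_norm s)
  refine ⟨hX.1.aemeasurable, hmom, ae_of_all _ fun ω => ?_⟩
  have hflow : (fun s => law (hmom s)) = marginal μ := by
    funext s
    exact Subtype.ext (marginal_eq_map hX.1.aemeasurable hlaw.symm s).symm
  rw [hflow]
  exact isPathSolution_solutionMap hT hp hK0 hb hK μ (ζ ω, W ω)

end Solution

end McKeanVlasov

theorem theorem2p3 {d : ℕ} {T : ℝ} {p : ℝ≥0} (hT : 0 < T) (hp : 1 ≤ p)
    (b : McKeanVlasov.Drift p T d) (hb : McKeanVlasov.DriftAssumption b) :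
    -- the maps `S^μ : ℝ^d × C_T → C_T` and `Φ : 𝒫_p(ℝ^d × C_T) × 𝒫_p(C_T) → 𝒫_p(C_T)`
    -- are well defined
    (∀ μ : McKeanVlasov.FiniteMoment p (McKeanVlasov.PathSpace T d),
      (∀ x₀ γ,
        McKeanVlasov.IsPathSolution b (McKeanVlasov.marginal μ) x₀ γ
          (McKeanVlasov.solutionMap b μ (x₀, γ)) ∧
        ∀ x, McKeanVlasov.IsPathSolution b (McKeanVlasov.marginal μ) x₀ γ x →
          x = McKeanVlasov.solutionMap b μ (x₀, γ)) ∧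
      Measurable (McKeanVlasov.solutionMap b μ) ∧
      ∀ ν, ∃ μ' : McKeanVlasov.FiniteMoment p (McKeanVlasov.PathSpace T d),
        μ'.1 = McKeanVlasov.lawMap b ν μ) ∧
    -- (i) `Φ(ν, ·)` has a unique fixed point in `𝒫_p(C_T)`
    (∀ ν, ∃! μ : McKeanVlasov.FiniteMoment p (McKeanVlasov.PathSpace T d),
      McKeanVlasov.lawMap b ν μ = μ.1) ∧
    -- the map `Ψ` from the law of the input to the fixed point, and the constant
    ∃ Ψ : McKeanVlasov.FiniteMoment p (McKeanVlasov.Space d × McKeanVlasov.PathSpace T d) →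
        McKeanVlasov.FiniteMoment p (McKeanVlasov.PathSpace T d),
      (∀ ν, McKeanVlasov.lawMap b ν (Ψ ν) = (Ψ ν).1) ∧
      ∃ C : ℝ≥0, 0 < C ∧
        -- (ii) `Ψ` is Lipschitz continuous
        (∀ ν₁ ν₂, McKeanVlasov.wasserstein p (Ψ ν₁).1 (Ψ ν₂).1 ≤
          C * McKeanVlasov.wasserstein p ν₁.1 ν₂.1) ∧
        -- (iii) existence, representation and uniqueness of the solution
        (∀ (Ω : Type*) [MeasurableSpace Ω] (P : Measure Ω) [IsProbabilityMeasure P]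
          (ζ : Ω → McKeanVlasov.Space d) (W : Ω → McKeanVlasov.PathSpace T d)
          (h : MemLp (fun ω => (ζ ω, W ω)) (p : ℝ≥0∞) P),
          ∃ X : Ω → McKeanVlasov.PathSpace T d,
          (∀ ω, X ω = McKeanVlasov.solutionMap b (Ψ (McKeanVlasov.law h)) (ζ ω, W ω)) ∧
          McKeanVlasov.IsSolution b P ζ W X ∧
          MemLp X (p : ℝ≥0∞) P ∧
          P.map X = (Ψ (McKeanVlasov.law h)).1 ∧
          ∀ X', McKeanVlasov.IsSolution b P ζ W X' → X' =ᵐ[P] X) ∧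
        -- (iv) stability; the law of the solution depends only on the law of the input
        (∀ (Ω₁ : Type*) [MeasurableSpace Ω₁] (P₁ : Measure Ω₁) [IsProbabilityMeasure P₁]
          (Ω₂ : Type*) [MeasurableSpace Ω₂] (P₂ : Measure Ω₂) [IsProbabilityMeasure P₂]
          (ζ₁ : Ω₁ → McKeanVlasov.Space d) (W₁ X₁ : Ω₁ → McKeanVlasov.PathSpace T d)
          (ζ₂ : Ω₂ → McKeanVlasov.Space d) (W₂ X₂ : Ω₂ → McKeanVlasov.PathSpace T d),
          MemLp (fun ω => (ζ₁ ω, W₁ ω)) (p : ℝ≥0∞) P₁ →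
          MemLp (fun ω => (ζ₂ ω, W₂ ω)) (p : ℝ≥0∞) P₂ →
          McKeanVlasov.IsSolution b P₁ ζ₁ W₁ X₁ →
          McKeanVlasov.IsSolution b P₂ ζ₂ W₂ X₂ →
          McKeanVlasov.wasserstein p (P₁.map X₁) (P₂.map X₂) ≤
            C * McKeanVlasov.wasserstein p
              (P₁.map fun ω => (ζ₁ ω, W₁ ω)) (P₂.map fun ω => (ζ₂ ω, W₂ ω)) ∧
          ((P₁.map fun ω => (ζ₁ ω, W₁ ω)) = (P₂.map fun ω => (ζ₂ ω, W₂ ω)) →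
            P₁.map X₁ = P₂.map X₂)) := by
  obtain ⟨K, hK0, hK⟩ := hb.exists_lipschitzDrift hp
  have hT0 := hT.le
  choose Ψ hΨ using fun ν => McKeanVlasov.exists_lawMap_eq hT0 hp hK0 hb hK ν
  refine ⟨fun μ => ⟨fun x₀ γ => ⟨?_, fun x hx => ?_⟩, ?_, fun ν => ?_⟩, fun ν => ?_, Ψ, hΨ,
    (Real.exp (4 * K * T) * 4).toNNReal, Real.toNNReal_pos.2 (by positivity), ?_, ?_, ?_⟩
  · exact McKeanVlasov.isPathSolution_solutionMap hT0 hp hK0 hb hK μ (x₀, γ)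
  · exact hx.unique hp hK0 hK
      (McKeanVlasov.isPathSolution_solutionMap hT0 hp hK0 hb hK μ (x₀, γ))
  · exact (McKeanVlasov.continuous_solutionMap hT0 hp hK0 hb hK μ).measurable
  · have := ν.2.1
    have hX := McKeanVlasov.memLp_solutionMap hT0 hp hK0 hb hK μ
      (McKeanVlasov.memLp_id_of_finiteMoment hp ν)
    exact ⟨McKeanVlasov.law hX, rfl⟩
  · exact ⟨Ψ ν, hΨ ν, fun μ hμ => McKeanVlasov.eq_of_lawMap_eq hT0 hp hK0 hb hK hμ (hΨ ν)⟩
  · exact fun ν₁ ν₂ => McKeanVlasov.wasserstein_le_of_lawMap_eq hT0 hp hK0 hb hK (hΨ ν₁) (hΨ ν₂)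
  · intro Ω _ P _ ζ W h
    exact ⟨_, fun ω => rfl, McKeanVlasov.isSolution_solutionMap hT0 hp hK0 hb hK h (hΨ _),
      McKeanVlasov.memLp_solutionMap hT0 hp hK0 hb hK _ h,
      McKeanVlasov.map_solutionMap_eq hT0 hp hK0 hb hK h.1.aemeasurable rfl (hΨ _),
      fun X' hX' => (hX'.map_eq_and_ae_eq hT0 hp hK0 hb hK h (hΨ _)).2⟩
  · intro Ω₁ _ P₁ _ Ω₂ _ P₂ _ ζ₁ W₁ X₁ ζ₂ W₂ X₂ h₁ h₂ hX₁ hX₂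
    rw [(hX₁.map_eq_and_ae_eq hT0 hp hK0 hb hK h₁ (hΨ _)).1,
      (hX₂.map_eq_and_ae_eq hT0 hp hK0 hb hK h₂ (hΨ _)).1]
    have hW := McKeanVlasov.wasserstein_le_of_lawMap_eq hT0 hp hK0 hb hK
      (hΨ (McKeanVlasov.law h₁)) (hΨ (McKeanVlasov.law h₂))
    refine ⟨hW, fun h => ?_⟩
    have heq : McKeanVlasov.law h₁ = McKeanVlasov.law h₂ := Subtype.ext h
    rw [heq]
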